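/- Let $s$ be a string of length $n$ whose letters are integers from $\{0,1,\dots,n\}$; positions are counted from $1$. An LZ77 parsing of $s$ is a factorization $s=f_1f_2\cdots f_z$ into non-empty strings (phrases) such that each $f_i$ either is a single letter, or has length $|f_i|>1$ and $f_i$ without its last letter has an occurrence in $s$ starting at some position $j\le |f_1\cdots f_{i-1}|$ (this occurrence may overlap $f_i$). The greedy parsing is the one in which, from left to right, each phrase is chosen as long as possible. A phrase $f_i$ is represented by a triple $\langle d,\ell,c\rangle$, where $\ell=|f_i|$, $c$ is the last letter of $f_i$, and $d=0$ if $|f_i|=1$, while otherwise $d=|f_1\cdots f_{i-1}|-j$ for the starting position $j\le|f_1\cdots f_{i-1}|$ of some occurrence as above. Let $e_d,e_\ell,e_c$ be maps from the non-negative integers to bit strings, each of which maps every positive integer $x$ to a bit string of length $\Theta(\log_2(x+1))$. An LZ77 encoding of $s$ is the concatenation of the bit strings $e_d(d)e_\ell(\ell)e_c(c)$ over the triples representing, in order, the phrases of an LZ77 parsing of $s$. Let $\mathsf{LZ_{opt}}(s)$ be the minimal size in bits of an LZ77 encoding of $s$, and $\mathsf{LZ_{gr}}(s)$ the minimal size in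 bits of an LZ77 encoding of $s$ that corresponds to the greedy parsing. **Theorem.** There is an absolute constant $C>0$ such that for any fixed encoders $e_d,e_\ell,e_c$ as above there is a constant $c>0$ with the following property: for every integer $n>1$ there is a string $s$ of length $n$ over an alphabet $A\subseteq\{0,1,\dots,n\}$ of size $|A|\le C\log_2 n$ such that $$\frac{\mathsf{LZ_{gr}}(s)}{\mathsf{LZ_{opt}}(s)}\ \ge\ c\log_2 n .$$ -/

import Mathlib

namespace LZ77

/-- `u` occurs in `s` starting at position `j`; positions are counted from `1`. -/
def OccursAt (u s : List ℕ) (j : ℕ) : Prop :=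
  1 ≤ j ∧ u <+: s.drop (j - 1)

/-- `f` may be used as a phrase of `s` right after the first `p` letters of `s`: it is a single
letter, or `f` without its last letter occurs in `s` at a position `j ≤ p` (the occurrence may
overlap the phrase). -/
def IsPhrase (s : List ℕ) (p : ℕ) (f : List ℕ) : Prop :=
  f.length = 1 ∨ (1 < f.length ∧ ∃ j, j ≤ p ∧ OccursAt f.dropLast s j)

/-- The total length of the phrases that precede the phrase with (zero-based) index `i`. -/
def startOf (fs : List (List ℕ)) (i : ℕ) : ℕ :=
  (fs.take i).flatten.length

/-- `fs` is an LZ77 parsing of `s`. -/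
def IsParsing (s : List ℕ) (fs : List (List ℕ)) : Prop :=
  fs.flatten = s ∧ ∀ (i : ℕ) (hi : i < fs.length), IsPhrase s (startOf fs i) fs[i]

/-- `fs` is the greedy LZ77 parsing of `s`: every phrase is the longest possible one among the
substrings of `s` that start at the same place. -/
def IsGreedyParsing (s : List ℕ) (fs : List (List ℕ)) : Prop :=
  IsParsing s fs ∧ ∀ (i : ℕ) (hi : i < fs.length) (g : List ℕ),
    g <+: s.drop (startOf fs i) → IsPhrase s (startOf fs i) g → g.length ≤ fs[i].length

/-- A triple `⟨d, ℓ, c⟩`: distance, length of the phrase, last letter of the phrase. -/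
structure Triple where
  d : ℕ
  len : ℕ
  c : ℕ

/-- The triple `t` represents the phrase `f` of `s` that is preceded by `p` letters: the length and
the last letter are those of `f`, and `d = p - j` for a position `j ≤ p` of an earlier occurrence of
`f` without its last letter, while `d = 0` if `f` is a single letter. -/
def Represents (s : List ℕ) (p : ℕ) (f : List ℕ) (t : Triple) : Prop :=
  t.len = f.length ∧ f.getLast? = some t.c ∧
    (f.length = 1 → t.d = 0) ∧
    (1 < f.length → ∃ j, j ≤ p ∧ OccursAt f.dropLast s j ∧ t.d = p - j)

/-- The list `ts` of triples represents the parsing `fs` of `s`, phrase by phrase. -/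
def RepresentsParsing (s : List ℕ) (fs : List (List ℕ)) (ts : List Triple) : Prop :=
  ∃ h : ts.length = fs.length,
    ∀ (i : ℕ) (hi : i < fs.length), Represents s (startOf fs i) fs[i] ts[i]

/-- `e` maps every positive integer `x` to a bit string of length `Θ(log (x + 1))`; the bit string
`e 0` is arbitrary. -/
def IsLogEncoder (e : ℕ → List Bool) : Prop :=
  ∃ a b : ℝ, 0 < a ∧ 0 < b ∧ ∀ x : ℕ, 1 ≤ x →
    a * Real.logb 2 ((x : ℝ) + 1) ≤ ((e x).length : ℝ) ∧
    ((e x).length : ℝ) ≤ b * Real.logb 2 ((x : ℝ) + 1)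

/-- Encoders for the three components of the triples. -/
structure Encoders where
  ed : ℕ → List Bool
  el : ℕ → List Bool
  ec : ℕ → List Bool
  ed_log : IsLogEncoder ed
  el_log : IsLogEncoder el
  ec_log : IsLogEncoder ec

/-- The bit string `e_d(d) e_ℓ(ℓ) e_c(c)`, concatenated over all triples of the list. -/
def Encoders.bits (E : Encoders) (ts : List Triple) : List Bool :=
  ts.flatMap fun t => E.ed t.d ++ E.el t.len ++ E.ec t.c

/-- `w` is an LZ77 encoding of `s`. -/
def Encoders.IsEncoding (E : Encoders) (s : List ℕ) (w : List Bool) : Prop :=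
  ∃ fs ts, IsParsing s fs ∧ RepresentsParsing s fs ts ∧ w = E.bits ts

/-- `w` is an LZ77 encoding of `s` that corresponds to the greedy parsing of `s`. -/
def Encoders.IsGreedyEncoding (E : Encoders) (s : List ℕ) (w : List Bool) : Prop :=
  ∃ fs ts, IsGreedyParsing s fs ∧ RepresentsParsing s fs ts ∧ w = E.bits ts

/-- The size in bits of an optimal LZ77 encoding of `s`. -/
noncomputable def Encoders.lzOpt (E : Encoders) (s : List ℕ) : ℕ :=
  sInf {m | ∃ w, E.IsEncoding s w ∧ w.length = m}

/-- The size in bits of a smallest LZ77 encoding of `s` that corresponds to the greedy parsing. -/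
noncomputable def Encoders.lzGr (E : Encoders) (s : List ℕ) : ℕ :=
  sInf {m | ∃ w, E.IsGreedyEncoding s w ∧ w.length = m}

end LZ77

/-! After a padding of `1`s, the string visits the cells of a 2^k × 2^k grid in Z-order, with 2^k =
Θ(log n), and writes for each cell its row letter, `1`, its column letter, `1`. Row and column
letters are all at least n/2, so each costs Ω(log n) bits whenever it is the last letter of a
phrase.

Greedy is forced to pay this price. A pair of row and column letters identifies its cell
(`zLetter_pair_ne`), so phrases past the padding have bounded length (`IsPhrase.length_le`). A
non-final phrase past the padding never ends in `1`: a large letter is always followed by `1`, so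
such a phrase could be prolonged (`le_last_of_greedy`). Hence Ω(4^k) phrases cost Ω(log n) bits
each.

A better parsing uses phrases "large letter, `1`": the large letter is copied and the explicit last
letter is cheap. In Z-order the copy distance is O(4^v), where v is the 2-adic valuation of the
other coordinate (`exists_prev_zRow_eq`, `exists_prev_zCol_eq`). The price O(v + 1) is O(1) on
average (`sum_reuseCost_le`), and only 2 · 2^k letters are written explicitly at O(log n) bits each.
The total is O(4^k), smaller by a factor Ω(log n). -/

namespace LZ77

/-! ### Z-order coordinates -/

/-- The first coordinate of the `t`-th cell in Z-order. -/
def zRow (t : ℕ) : ℕ :=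
  if t = 0 then 0 else 2 * zRow (t / 4) + t % 4 / 2
decreasing_by omega

/-- The second coordinate of the `t`-th cell in Z-order. -/
def zCol (t : ℕ) : ℕ :=
  if t = 0 then 0 else 2 * zCol (t / 4) + t % 2
decreasing_by omega

lemma zRow_zero : zRow 0 = 0 := by rw [zRow, if_pos rfl]

lemma zCol_zero : zCol 0 = 0 := by rw [zCol, if_pos rfl]

lemma zRow_eq (t : ℕ) : zRow t = 2 * zRow (t / 4) + t % 4 / 2 := by
  rcases eq_or_ne t 0 with rfl | h
  · simp [zRow]
  · rw [zRow, if_neg h]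

lemma zCol_eq (t : ℕ) : zCol t = 2 * zCol (t / 4) + t % 2 := by
  rcases eq_or_ne t 0 with rfl | h
  · simp [zCol]
  · rw [zCol, if_neg h]

lemma zRow_four_mul_add (q r : ℕ) (hr : r < 4) : zRow (4 * q + r) = 2 * zRow q + r / 2 := by
  rw [zRow_eq, show (4 * q + r) / 4 = q by omega, show (4 * q + r) % 4 = r by omega]

lemma zCol_four_mul_add (q r : ℕ) (hr : r < 4) : zCol (4 * q + r) = 2 * zCol q + r % 2 := by
  rw [zCol_eq, show (4 * q + r) / 4 = q by omega, show (4 * q + r) % 2 = r % 2 by omega]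

lemma zRow_lt (k t : ℕ) (ht : t < 4 ^ k) : zRow t < 2 ^ k := by
  induction k generalizing t with
  | zero => simp_all [zRow]
  | succ k ih =>
    have := ih (t / 4) (by rw [pow_succ] at ht; omega)
    rw [zRow_eq, pow_succ]
    omega

lemma zCol_lt (k t : ℕ) (ht : t < 4 ^ k) : zCol t < 2 ^ k := by
  induction k generalizing t with
  | zero => simp_all [zCol]
  | succ k ih =>
    have := ih (t / 4) (by rw [pow_succ] at ht; omega)
    rw [zCol_eq, pow_succ]
    omega

/-- The base-4 digits of `t` interleave the binary digits of the two coordinates. -/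
lemma eq_of_zRow_eq_of_zCol_eq (t t' : ℕ) (hr : zRow t = zRow t') (hc : zCol t = zCol t') :
    t = t' := by
  induction t using Nat.strong_induction_on generalizing t' with
  | _ t ih =>
    have h1 := zRow_eq t
    have h2 := zRow_eq t'
    have h3 := zCol_eq t
    have h4 := zCol_eq t'
    rcases eq_or_ne t 0 with rfl | h0
    -- At `t = 0` the quotient does not decrease, so the descent runs on the other index.
    · by_contra hne
      have key : ∀ u, zRow u = 0 → zCol u = 0 → u = 0 := by
        intro u
        induction u using Nat.strong_induction_on with
        | _ u ih' =>
          intro a b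
          by_contra hu
          have e1 := zRow_eq u
          have e2 := zCol_eq u
          have := ih' (u / 4) (by omega) (by omega) (by omega)
          omega
      exact hne (key t' (by rw [← hr, zRow_zero]) (by rw [← hc, zCol_zero])).symm
    · have := ih (t / 4) (by omega) (t' / 4) (by omega) (by omega)
      omega

lemma padicValNat_two_mul (m : ℕ) (hm : m ≠ 0) :
    padicValNat 2 (2 * m) = padicValNat 2 m + 1 := by
  rw [padicValNat.mul two_ne_zero hm, padicValNat_self, add_comm]

lemma padicValNat_two_mul_add_one (m : ℕ) : padicValNat 2 (2 * m + 1) = 0 :=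
  padicValNat.eq_zero_of_not_dvd (by omega)

/-- A cell that is not in the first column is preceded in Z-order, not far away, by a cell of the
same row. -/
lemma exists_prev_zRow_eq (t : ℕ) (ht : zCol t ≠ 0) :
    ∃ t' < t, zRow t' = zRow t ∧ t - t' ≤ 4 ^ padicValNat 2 (zCol t) := by
  induction t using Nat.strong_induction_on with
  | _ t ih =>
    obtain ⟨q, r, hr, rfl⟩ : ∃ q r, r < 4 ∧ t = 4 * q + r :=
      ⟨t / 4, t % 4, by omega, by omega⟩
    rw [zCol_four_mul_add q r hr] at ht ⊢
    rcases Nat.mod_two_eq_zero_or_one r with h | h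
    -- Even column: pass to the grid of 2 × 2 blocks. Distances grow by a factor 4 and the valuation
    -- by 1.
    · rw [h, add_zero] at ht ⊢
      have hq : zCol q ≠ 0 := by omega
      have hq0 : q ≠ 0 := by rintro rfl; simp [zCol] at hq
      obtain ⟨q', hlt, he, hd⟩ := ih q (by omega) hq
      refine ⟨4 * q' + r, by omega, ?_, ?_⟩
      · rw [zRow_four_mul_add _ _ hr, zRow_four_mul_add _ _ hr, he]
      · rw [padicValNat_two_mul _ hq, pow_succ]
        omega
    -- Odd column: the left neighbour lies in the same 2 × 2 block.
    · refine ⟨4 * q + (r - 1), by omega, ?_, ?_⟩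
      · rw [zRow_four_mul_add _ _ hr, zRow_four_mul_add _ _ (by omega)]
        omega
      · rw [h, padicValNat_two_mul_add_one]
        omega

/-- A cell that is not in the first row is preceded in Z-order, not far away, by a cell of the
same column. -/
lemma exists_prev_zCol_eq (t : ℕ) (ht : zRow t ≠ 0) :
    ∃ t' < t, zCol t' = zCol t ∧ t - t' ≤ 2 * 4 ^ padicValNat 2 (zRow t) := by
  induction t using Nat.strong_induction_on with
  | _ t ih =>
    obtain ⟨q, r, hr, rfl⟩ : ∃ q r, r < 4 ∧ t = 4 * q + r :=
      ⟨t / 4, t % 4, by omega, by omega⟩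
    rw [zRow_four_mul_add q r hr] at ht ⊢
    rcases (by omega : r / 2 = 0 ∨ r / 2 = 1) with h | h
    · rw [h, add_zero] at ht ⊢
      have hq : zRow q ≠ 0 := by omega
      have hq0 : q ≠ 0 := by rintro rfl; simp [zRow] at hq
      obtain ⟨q', hlt, he, hd⟩ := ih q (by omega) hq
      refine ⟨4 * q' + r, by omega, ?_, ?_⟩
      · rw [zCol_four_mul_add _ _ hr, zCol_four_mul_add _ _ hr, he]
      · rw [padicValNat_two_mul _ hq, pow_succ]
        omega
    -- The upper neighbour in the block is two steps back, whence the factor 2 in the bound.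
    · refine ⟨4 * q + (r - 2), by omega, ?_, ?_⟩
      · rw [zCol_four_mul_add _ _ hr, zCol_four_mul_add _ _ (by omega)]
        omega
      · rw [h, padicValNat_two_mul_add_one]
        omega

/-- The cost, up to a factor, of a letter whose index has been paired with `c` smaller indices
before: `G` for the first use, and logarithmic in the distance to the previous use otherwise. -/
def reuseCost (G c : ℕ) : ℕ := if c = 0 then G else 2 * padicValNat 2 c + 9

lemma reuseCost_two_mul_le (G c : ℕ) : reuseCost G (2 * c) ≤ reuseCost G c + 2 := by
  rcases eq_or_ne c 0 with rfl | h
  · simp [reuseCost]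
  · simp only [reuseCost, h, mul_eq_zero, two_ne_zero, or_self, if_false]
    rw [padicValNat_two_mul _ h]
    omega

lemma reuseCost_two_mul_add_one (G c : ℕ) : reuseCost G (2 * c + 1) = 9 := by
  simp [reuseCost, padicValNat_two_mul_add_one]

lemma sum_range_four_mul (f : ℕ → ℕ) (m : ℕ) :
    ∑ t ∈ Finset.range (4 * m), f t =
      ∑ q ∈ Finset.range m, (f (4 * q) + f (4 * q + 1) + f (4 * q + 2) + f (4 * q + 3)) := by
  induction m with
  | zero => simp
  | succ m ih =>
    rw [Finset.sum_range_succ, ← ih, show 4 * (m + 1) = 4 * m + 1 + 1 + 1 + 1 by ring]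
    simp only [Finset.sum_range_succ]
    ring

/-- By `hz`, each 2 × 2 block takes the coordinates `2 * z q` and `2 * z q + 1` twice each. The odd
ones cost 9 and the even ones at most 2 more than `z q`, so S(k + 1) ≤ 2 S(k) + 22 · 4^k. -/
lemma sum_reuseCost_le (z : ℕ → ℕ) (h0 : z 0 = 0)
    (hz : ∀ (f : ℕ → ℕ) (q : ℕ),
      f (z (4 * q)) + f (z (4 * q + 1)) + f (z (4 * q + 2)) + f (z (4 * q + 3)) =
        2 * (f (2 * z q) + f (2 * z q + 1))) (G k : ℕ) :
    ∑ t ∈ Finset.range (4 ^ k), reuseCost G (z t) ≤ 2 ^ k * G + 11 * 4 ^ k := by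
  induction k with
  | zero => simp [h0, reuseCost]
  | succ k ih =>
    have step : ∑ t ∈ Finset.range (4 ^ (k + 1)), reuseCost G (z t) ≤
        ∑ q ∈ Finset.range (4 ^ k), (2 * reuseCost G (z q) + 22) := by
      rw [pow_succ, mul_comm, sum_range_four_mul]
      refine Finset.sum_le_sum fun q _ => ?_
      rw [hz, reuseCost_two_mul_add_one]
      have := reuseCost_two_mul_le G (z q)
      omega
    rw [Finset.sum_add_distrib, ← Finset.mul_sum] at step
    simp only [Finset.sum_const, Finset.card_range, smul_eq_mul] at step
    rw [pow_succ 2 k, pow_succ 4 k]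
    rw [pow_succ 4 k] at step
    linarith

lemma sum_reuseCost_zCol_le (G k : ℕ) :
    ∑ t ∈ Finset.range (4 ^ k), reuseCost G (zCol t) ≤ 2 ^ k * G + 11 * 4 ^ k := by
  refine sum_reuseCost_le zCol zCol_zero (fun f q => ?_) G k
  have h0 := zCol_four_mul_add q 0 (by norm_num)
  rw [zCol_four_mul_add q 1 (by norm_num), zCol_four_mul_add q 2 (by norm_num),
    zCol_four_mul_add q 3 (by norm_num)]
  norm_num at h0 ⊢
  rw [h0]
  ring

lemma sum_reuseCost_zRow_le (G k : ℕ) :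
    ∑ t ∈ Finset.range (4 ^ k), reuseCost G (zRow t) ≤ 2 ^ k * G + 11 * 4 ^ k := by
  refine sum_reuseCost_le zRow zRow_zero (fun f q => ?_) G k
  have h0 := zRow_four_mul_add q 0 (by norm_num)
  rw [zRow_four_mul_add q 1 (by norm_num), zRow_four_mul_add q 2 (by norm_num),
    zRow_four_mul_add q 3 (by norm_num)]
  norm_num at h0 ⊢
  rw [h0]
  ring

/-! ### Parsings built phrase by phrase -/

/-- The size in bits of the code of a triple. -/
def Encoders.cost (E : Encoders) (t : Triple) : ℕ :=
  (E.ed t.d).length + (E.el t.len).length + (E.ec t.c).length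

lemma Encoders.length_bits_append (E : Encoders) (ts : List Triple) (t : Triple) :
    (E.bits (ts ++ [t])).length = (E.bits ts).length + E.cost t := by
  simp [Encoders.bits, Encoders.cost, add_assoc]

lemma startOf_append_of_le (fs : List (List ℕ)) (f : List ℕ) (i : ℕ) (hi : i ≤ fs.length) :
    startOf (fs ++ [f]) i = startOf fs i := by
  simp [startOf, List.take_append_of_le_length hi]

lemma startOf_length (fs : List (List ℕ)) : startOf fs fs.length = fs.flatten.length := by
  simp [startOf]

lemma startOf_succ (fs : List (List ℕ)) (i : ℕ) (hi : i < fs.length) :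
    startOf fs (i + 1) = startOf fs i + fs[i].length := by
  simp only [startOf]
  rw [List.take_succ_eq_append_getElem hi, List.flatten_append, List.length_append]
  simp

lemma startOf_le (fs : List (List ℕ)) (i : ℕ) : startOf fs i ≤ fs.flatten.length := by
  conv_rhs => rw [← List.take_append_drop i fs, List.flatten_append, List.length_append]
  exact Nat.le_add_right _ _

lemma forall_phrase_append {Φ : ℕ → List ℕ → Prop} {fs : List (List ℕ)} {f : List ℕ}
    (h : ∀ (i : ℕ) (hi : i < fs.length), Φ (startOf fs i) fs[i]) (hf : Φ fs.flatten.length f)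
    (i : ℕ) (hi : i < (fs ++ [f]).length) : Φ (startOf (fs ++ [f]) i) (fs ++ [f])[i] := by
  have hi' : i ≤ fs.length := by simpa [Nat.lt_succ_iff] using hi
  rw [startOf_append_of_le _ _ _ hi']
  rcases hi'.lt_or_eq with hlt | rfl
  · rw [List.getElem_append_left hlt]
    exact h i hlt
  · simpa [startOf_length] using hf

lemma Represents.isPhrase {s : List ℕ} {p : ℕ} {f : List ℕ} {t : Triple}
    (h : Represents s p f t) : IsPhrase s p f := by
  obtain ⟨-, hc, -, hd⟩ := h
  rcases lt_trichotomy f.length 1 with h1 | h1 | h1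
  · have : f = [] := List.length_eq_zero_iff.mp (by omega)
    simp [this] at hc
  · exact Or.inl h1
  · obtain ⟨j, hj, ho, -⟩ := hd h1
    exact Or.inr ⟨h1, j, hj, ho⟩

lemma IsPhrase.exists_represents {s : List ℕ} {p : ℕ} {f : List ℕ} (h : IsPhrase s p f) :
    ∃ t, Represents s p f t := by
  have hf : f ≠ [] := by
    rintro rfl
    rcases h with h | h <;> simp at h
  rcases h with h | ⟨h, j, hj, ho⟩
  · exact ⟨⟨0, f.length, f.getLast hf⟩, rfl, List.getLast?_eq_some_getLast hf, fun _ => rfl,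
      fun h' => by omega⟩
  · exact ⟨⟨p - j, f.length, f.getLast hf⟩, rfl, List.getLast?_eq_some_getLast hf,
      fun h' => by omega, fun _ => ⟨j, hj, ho, rfl⟩⟩

lemma RepresentsParsing.isParsing {s : List ℕ} {fs : List (List ℕ)} {ts : List Triple}
    (h : RepresentsParsing s fs ts) (hs : fs.flatten = s) : IsParsing s fs :=
  ⟨hs, fun i hi => (h.2 i hi).isPhrase⟩

lemma IsParsing.exists_representsParsing {s : List ℕ} {fs : List (List ℕ)}
    (h : IsParsing s fs) : ∃ ts, RepresentsParsing s fs ts := by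
  choose t ht using fun (i : Fin fs.length) => (h.2 i i.2).exists_represents
  refine ⟨List.ofFn t, by simp, fun i hi => ?_⟩
  simpa using ht ⟨i, hi⟩

/-- Every string has a greedy parsing. -/
lemma exists_isGreedyParsing (s : List ℕ) : ∃ fs, IsGreedyParsing s fs := by
  have key : ∀ m p, p ≤ s.length → s.length - p ≤ m → ∀ fs : List (List ℕ),
      fs.flatten = s.take p →
      (∀ (i : ℕ) (hi : i < fs.length), IsPhrase s (startOf fs i) fs[i] ∧
        ∀ g, g <+: s.drop (startOf fs i) → IsPhrase s (startOf fs i) g →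
          g.length ≤ fs[i].length) →
      ∃ fs, IsGreedyParsing s fs := by
    intro m
    induction m with
    | zero =>
      intro p hp hm fs hfs h
      rw [List.take_of_length_le (by omega)] at hfs
      exact ⟨fs, ⟨hfs, fun i hi => (h i hi).1⟩, fun i hi => (h i hi).2⟩
    | succ m ih =>
      intro p hp hm fs hfs h
      rcases hp.lt_or_eq with hlt | rfl
      · have hlen : fs.flatten.length = p := by rw [hfs]; simp [hp]
        let P : ℕ → Prop := fun l => ∃ g, g <+: s.drop p ∧ IsPhrase s p g ∧ g.length = l
        classical
        -- A single letter is always admissible, so a longest phrase exists.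
        have h1 : P 1 := ⟨(s.drop p).take 1, List.take_prefix _ _,
          Or.inl (by simp; omega), by simp; omega⟩
        have hmax := Nat.findGreatest_spec (P := P) (n := s.length) (by omega : 1 ≤ s.length) h1
        obtain ⟨f, hf1, hf2, hf3⟩ := hmax
        have hfmax : ∀ g, g <+: s.drop p → IsPhrase s p g → g.length ≤ f.length := by
          intro g hg hg'
          rw [hf3]
          refine Nat.le_findGreatest ?_ ⟨g, hg, hg', rfl⟩
          have := hg.length_le
          simp at this
          omega
        have hfpos : 1 ≤ f.length := by
          rcases hf2 with h | h <;> omega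
        have hfle := hf1.length_le
        rw [List.length_drop] at hfle
        refine ih (p + f.length) (by omega) (by omega) (fs ++ [f]) ?_ ?_
        · rw [List.take_add, List.flatten_append, hfs, ← List.prefix_iff_eq_take.mp hf1]
          simp
        · exact forall_phrase_append
            (Φ := fun p f => IsPhrase s p f ∧ ∀ g, g <+: s.drop p → IsPhrase s p g →
              g.length ≤ f.length) h (by rw [hlen]; exact ⟨hf2, hfmax⟩)
      · exact ih s.length le_rfl (by omega) fs hfs h
  exact key s.length 0 (Nat.zero_le _) (by omega) [] (by simp) (by simp)

/-- Rules out the default value 0 of an infimum over the empty set, for `lzGr` and hence for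
`lzOpt`. -/
lemma Encoders.exists_isGreedyEncoding (E : Encoders) (s : List ℕ) :
    ∃ w, E.IsGreedyEncoding s w := by
  obtain ⟨fs, hfs⟩ := exists_isGreedyParsing s
  obtain ⟨ts, hts⟩ := hfs.1.exists_representsParsing
  exact ⟨_, fs, ts, hfs, hts, rfl⟩

lemma Encoders.IsGreedyEncoding.isEncoding {E : Encoders} {s : List ℕ} {w : List Bool}
    (h : E.IsGreedyEncoding s w) : E.IsEncoding s w := by
  obtain ⟨fs, ts, hfs, hts, hw⟩ := h
  exact ⟨fs, ts, hfs.1, hts, hw⟩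

lemma Encoders.lzOpt_le (E : Encoders) {s : List ℕ} {w : List Bool} (h : E.IsEncoding s w) :
    E.lzOpt s ≤ w.length :=
  Nat.sInf_le ⟨w, h, rfl⟩

lemma Encoders.exists_length_eq_lzGr (E : Encoders) (s : List ℕ) :
    ∃ w, E.IsGreedyEncoding s w ∧ w.length = E.lzGr s := by
  obtain ⟨w, hw⟩ := E.exists_isGreedyEncoding s
  exact Nat.sInf_mem (s := {m | ∃ w, E.IsGreedyEncoding s w ∧ w.length = m}) ⟨_, w, hw, rfl⟩

lemma Encoders.exists_length_eq_lzOpt (E : Encoders) (s : List ℕ) :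
    ∃ w, E.IsEncoding s w ∧ w.length = E.lzOpt s := by
  obtain ⟨w, hw⟩ := E.exists_isGreedyEncoding s
  exact Nat.sInf_mem (s := {m | ∃ w, E.IsEncoding s w ∧ w.length = m})
    ⟨_, w, hw.isEncoding, rfl⟩

lemma Encoders.lzOpt_le_lzGr (E : Encoders) (s : List ℕ) : E.lzOpt s ≤ E.lzGr s := by
  obtain ⟨w, hw, h⟩ := E.exists_length_eq_lzGr s
  exact h ▸ E.lzOpt_le hw.isEncoding

lemma IsLogEncoder.length_pos {e : ℕ → List Bool} (he : IsLogEncoder e) {x : ℕ} (hx : 1 ≤ x) :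
    0 < (e x).length := by
  obtain ⟨a, b, ha, -, h⟩ := he
  have h1 := (h x hx).1
  have hx' : (1 : ℝ) ≤ x := by exact_mod_cast hx
  have h2 : 0 < a * Real.logb 2 ((x : ℝ) + 1) :=
    mul_pos ha (Real.logb_pos (by norm_num) (by linarith))
  exact_mod_cast h2.trans_le h1

/-- Makes the ratio a genuine quotient. The bits come from the length component of the first triple,
since `e_d(0)` and `e_c(0)` may be empty. -/
lemma Encoders.lzOpt_pos (E : Encoders) {s : List ℕ} (hs : s ≠ []) : 0 < E.lzOpt s := by
  obtain ⟨w, ⟨fs, ts, hfs, ⟨hlen, hts⟩, rfl⟩, h⟩ := E.exists_length_eq_lzOpt s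
  rw [← h]
  have hfs0 : 0 < fs.length := by
    rw [List.length_pos_iff]
    rintro rfl
    exact hs (by simpa using hfs.1.symm)
  obtain ⟨t, ts', rfl⟩ := List.exists_cons_of_length_pos (hlen ▸ hfs0)
  have ht := hts 0 hfs0
  have hpos : 1 ≤ t.len := by
    have h1 : t.len = fs[0].length := ht.1
    rcases ht.isPhrase with h | h <;> omega
  have := E.el_log.length_pos hpos
  simp [Encoders.bits]
  omega

/-- The first `p` letters of `s` have a parsing whose encoding takes at most `w` bits. -/
def Encoders.Reaches (E : Encoders) (s : List ℕ) (p w : ℕ) : Prop :=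
  p ≤ s.length ∧ ∃ fs ts, fs.flatten = s.take p ∧ RepresentsParsing s fs ts ∧
    (E.bits ts).length ≤ w

lemma Encoders.reaches_zero (E : Encoders) (s : List ℕ) : E.Reaches s 0 0 :=
  ⟨Nat.zero_le _, [], [], by simp, ⟨rfl, by simp⟩, by simp [Encoders.bits]⟩

lemma Encoders.Reaches.mono {E : Encoders} {s : List ℕ} {p w w' : ℕ} (h : E.Reaches s p w)
    (hw : w ≤ w') : E.Reaches s p w' := by
  obtain ⟨hp, fs, ts, h1, h2, h3⟩ := h
  exact ⟨hp, fs, ts, h1, h2, h3.trans hw⟩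

lemma Encoders.Reaches.lzOpt_le {E : Encoders} {s : List ℕ} {w : ℕ}
    (h : E.Reaches s s.length w) : E.lzOpt s ≤ w := by
  obtain ⟨hp, fs, ts, h1, h2, h3⟩ := h
  rw [List.take_length] at h1
  exact (E.lzOpt_le ⟨fs, ts, h2.isParsing h1, h2, rfl⟩).trans h3

lemma Encoders.Reaches.append {E : Encoders} {s f : List ℕ} {p w : ℕ} {t : Triple}
    (h : E.Reaches s p w) (hf : f <+: s.drop p) (ht : Represents s p f t) :
    E.Reaches s (p + f.length) (w + E.cost t) := by
  obtain ⟨hp, fs, ts, h1, ⟨hlen, h2⟩, h3⟩ := h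
  have hfle := hf.length_le
  rw [List.length_drop] at hfle
  have hlen' : fs.flatten.length = p := by rw [h1]; simp [hp]
  refine ⟨by omega, fs ++ [f], ts ++ [t], ?_, ⟨by simp [hlen], fun i hi => ?_⟩, ?_⟩
  · rw [List.take_add, List.flatten_append, h1, ← List.prefix_iff_eq_take.mp hf]
    simp
  · have hi' : i ≤ fs.length := by simpa [Nat.lt_succ_iff] using hi
    rw [startOf_append_of_le _ _ _ hi']
    rcases hi'.lt_or_eq with hlt | rfl
    · rw [List.getElem_append_left hlt, List.getElem_append_left (hlen ▸ hlt)]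
      exact h2 i hlt
    · rw [startOf_length, hlen']
      simpa [← hlen] using ht
  · rw [E.length_bits_append]
    omega

/-! ### Factors of a string given by a function -/

/-- The letters `g a, …, g (a + l - 1)`. -/
def factor (g : ℕ → ℕ) (a l : ℕ) : List ℕ := (List.range l).map fun i => g (a + i)

@[simp] lemma length_factor (g : ℕ → ℕ) (a l : ℕ) : (factor g a l).length = l := by
  simp [factor]

lemma factor_succ (g : ℕ → ℕ) (a l : ℕ) : factor g a (l + 1) = factor g a l ++ [g (a + l)] := by
  simp [factor, List.range_succ]

lemma factor_congr {g : ℕ → ℕ} {a b l : ℕ} :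
    factor g a l = factor g b l ↔ ∀ i < l, g (a + i) = g (b + i) := by
  simp [factor]

lemma drop_factor (g : ℕ → ℕ) (n a : ℕ) : (factor g 0 n).drop a = factor g a (n - a) := by
  apply List.ext_getElem <;> simp [factor]

lemma factor_prefix {g : ℕ → ℕ} {a l m : ℕ} (h : l ≤ m) : factor g a l <+: factor g a m := by
  rw [List.prefix_iff_eq_take]
  apply List.ext_getElem
  · simp [h]
  · simp [factor]

lemma factor_prefix_drop {g : ℕ → ℕ} {a l n : ℕ} (h : a + l ≤ n) :
    factor g a l <+: (factor g 0 n).drop a := by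
  rw [drop_factor]
  exact factor_prefix (by omega)

lemma eq_factor_of_prefix_drop {g : ℕ → ℕ} {n a : ℕ} {u : List ℕ}
    (h : u <+: (factor g 0 n).drop a) : u = factor g a u.length := by
  rw [drop_factor] at h
  have hl := h.length_le
  rw [length_factor] at hl
  rw [List.prefix_iff_eq_take.mp (factor_prefix (g := g) (a := a) hl)]
  conv_lhs => rw [List.prefix_iff_eq_take.mp h]
  simp

lemma OccursAt.eq_of_lt {g : ℕ → ℕ} {n a j l : ℕ} (h : OccursAt (factor g a l) (factor g 0 n) j)
    {i : ℕ} (hi : i < l) : g (a + i) = g (j - 1 + i) := by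
  have := eq_factor_of_prefix_drop h.2
  rw [length_factor] at this
  exact factor_congr.mp this i hi

lemma occursAt_factor {g : ℕ → ℕ} {n a b l : ℕ} (hb : b + l ≤ n)
    (h : ∀ i < l, g (a + i) = g (b + i)) : OccursAt (factor g a l) (factor g 0 n) (b + 1) := by
  refine ⟨by omega, ?_⟩
  rw [factor_congr.mpr h, Nat.add_sub_cancel]
  exact factor_prefix_drop hb

lemma Encoders.Reaches.letter {E : Encoders} {g : ℕ → ℕ} {n p w : ℕ}
    (h : E.Reaches (factor g 0 n) p w) (hp : p < n) :
    E.Reaches (factor g 0 n) (p + 1) (w + E.cost ⟨0, 1, g p⟩) := by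
  have := h.append (f := factor g p 1) (t := ⟨0, 1, g p⟩) (factor_prefix_drop hp)
    ⟨by simp, by simp [factor], fun _ => rfl, by simp⟩
  simpa using this

/-- The source `b` counts from 0, so it is position `b + 1` in the sense of `OccursAt`. The source
may overlap the phrase. -/
lemma Encoders.Reaches.copy {E : Encoders} {g : ℕ → ℕ} {n p w b l : ℕ}
    (h : E.Reaches (factor g 0 n) p w) (hl : 1 ≤ l) (hn : p + l < n) (hb : b < p)
    (hg : ∀ i < l, g (p + i) = g (b + i)) :
    E.Reaches (factor g 0 n) (p + (l + 1)) (w + E.cost ⟨p - (b + 1), l + 1, g (p + l)⟩) := by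
  have := h.append (f := factor g p (l + 1)) (t := ⟨p - (b + 1), l + 1, g (p + l)⟩)
    (factor_prefix_drop hn)
    ⟨by simp, by simp [factor_succ], by simp; omega, fun _ => ⟨b + 1, hb, by
      rw [factor_succ, List.dropLast_concat]
      exact occursAt_factor (by omega) hg, rfl⟩⟩
  simpa using this

/-! ### Bounds on the size of codes -/

lemma IsLogEncoder.exists_length_le {e : ℕ → List Bool} (he : IsLogEncoder e) :
    ∃ B : ℕ, ∀ x, (e x).length ≤ B * (Nat.size x + 1) := by
  obtain ⟨a, b, -, hb, h⟩ := he
  -- The second summand pays for `e 0`, which the encoder leaves unconstrained.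
  refine ⟨⌈b⌉₊ + (e 0).length, fun x => ?_⟩
  rcases Nat.eq_zero_or_pos x with rfl | hx
  · simp
  · have h1 := (h x hx).2
    have h2 : Real.logb 2 ((x : ℝ) + 1) ≤ Nat.size x + 1 := by
      rw [Real.logb_le_iff_le_rpow (by norm_num) (by positivity)]
      have : x + 1 ≤ 2 ^ (Nat.size x + 1) := by
        have := Nat.lt_size_self x
        rw [pow_succ]
        omega
      exact_mod_cast this
    have h3 : ((e x).length : ℝ) ≤ (⌈b⌉₊ : ℝ) * (Nat.size x + 1) :=
      h1.trans (mul_le_mul (Nat.le_ceil b) h2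
        (Real.logb_nonneg (by norm_num) (by linarith [(Nat.cast_nonneg x : (0 : ℝ) ≤ x)]))
        (by positivity))
    have h4 : (e x).length ≤ ⌈b⌉₊ * (Nat.size x + 1) := by exact_mod_cast h3
    exact h4.trans (Nat.mul_le_mul_right _ (by omega))

lemma Encoders.exists_cost_le (E : Encoders) :
    ∃ B : ℕ, 0 < B ∧ ∀ t : Triple,
      E.cost t ≤ B * (Nat.size t.d + Nat.size t.len + Nat.size t.c + 3) := by
  obtain ⟨B1, h1⟩ := E.ed_log.exists_length_le
  obtain ⟨B2, h2⟩ := E.el_log.exists_length_le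
  obtain ⟨B3, h3⟩ := E.ec_log.exists_length_le
  refine ⟨B1 + B2 + B3 + 1, by omega, fun t => ?_⟩
  have := h1 t.d
  have := h2 t.len
  have := h3 t.c
  unfold Encoders.cost
  nlinarith [Nat.zero_le B1, Nat.zero_le B2, Nat.zero_le B3,
    mul_nonneg (Nat.zero_le B1) (Nat.zero_le (Nat.size t.len)),
    mul_nonneg (Nat.zero_le B1) (Nat.zero_le (Nat.size t.c)),
    mul_nonneg (Nat.zero_le B2) (Nat.zero_le (Nat.size t.d)),
    mul_nonneg (Nat.zero_le B2) (Nat.zero_le (Nat.size t.c)),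
    mul_nonneg (Nat.zero_le B3) (Nat.zero_le (Nat.size t.len)),
    mul_nonneg (Nat.zero_le B3) (Nat.zero_le (Nat.size t.d))]

end LZ77

namespace LZ77

/-! ### The string -/

/-- The letters of the string: `1` at the first `p` positions; then, for the cells `(i, j)` in
Z-order, the four letters `h + 2 * i`, `1`, `h + 2 * j + 1`, `1`. -/
def zLetter (p h m : ℕ) : ℕ :=
  if m < p ∨ (m - p) % 2 = 1 then 1
  else if (m - p) % 4 = 0 then h + 2 * zRow ((m - p) / 4)
  else h + 2 * zCol ((m - p) / 4) + 1

section
variable {p h : ℕ}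

lemma zLetter_of_lt {m : ℕ} (hm : m < p) : zLetter p h m = 1 := by simp [zLetter, hm]

lemma zLetter_row (t : ℕ) : zLetter p h (p + 4 * t) = h + 2 * zRow t := by
  have h1 : p + 4 * t - p = 4 * t := by omega
  rw [zLetter, h1, if_neg (by omega), if_pos (by omega), Nat.mul_div_cancel_left _ (by norm_num)]

lemma zLetter_col (t : ℕ) : zLetter p h (p + 4 * t + 2) = h + 2 * zCol t + 1 := by
  have h1 : p + 4 * t + 2 - p = 4 * t + 2 := by omega
  rw [zLetter, h1, if_neg (by omega), if_neg (by omega), show (4 * t + 2) / 4 = t by omega]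

lemma zLetter_of_odd {m : ℕ} (hm : (m - p) % 2 = 1) : zLetter p h m = 1 := by
  simp [zLetter, hm]

lemma zLetter_eq_one_or (m : ℕ) : zLetter p h m = 1 ∨
    (p ≤ m ∧ (m - p) % 2 = 0 ∧ h ≤ zLetter p h m) := by
  by_cases hm : m < p ∨ (m - p) % 2 = 1
  · exact Or.inl (by rw [zLetter, if_pos hm])
  · refine Or.inr ⟨by omega, by omega, ?_⟩
    rw [zLetter, if_neg hm]
    split_ifs <;> omega

lemma zLetter_of_even {m : ℕ} (hp : p ≤ m) (hm : (m - p) % 2 = 0) :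
    h ≤ zLetter p h m := by
  rw [zLetter, if_neg (by omega)]
  split_ifs <;> omega

/-- The letters of a cell determine the position of the cell. -/
lemma zLetter_pair_ne (hh : 2 ≤ h) {t m : ℕ} (hm : m ≠ p + 4 * t)
    (h1 : zLetter p h (p + 4 * t) = zLetter p h m)
    (h2 : zLetter p h (p + 4 * t + 2) = zLetter p h (m + 2)) : False := by
  rw [zLetter_row] at h1
  rw [zLetter_col] at h2
  rcases zLetter_eq_one_or (p := p) (h := h) m with h3 | ⟨hp, h3, -⟩
  · omega
  rcases (by omega : (m - p) % 4 = 0 ∨ (m - p) % 4 = 2) with h4 | h4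
  · obtain ⟨t', rfl⟩ : ∃ t', m = p + 4 * t' := ⟨(m - p) / 4, by omega⟩
    rw [zLetter_row] at h1
    rw [zLetter_col] at h2
    exact hm (by rw [eq_of_zRow_eq_of_zCol_eq t t' (by omega) (by omega)])
  -- Row and column letters differ in parity relative to `h`.
  · obtain ⟨t', rfl⟩ : ∃ t', m = p + 4 * t' + 2 := ⟨(m - p) / 4, by omega⟩
    rw [zLetter_col] at h1
    omega

/-! ### The greedy parsing of the string -/

/-- A cell starts within 3 letters, its pair of large letters spans 3 more, and the last letter is
free. A longer phrase would copy a whole pair from an earlier place, against `zLetter_pair_ne`. -/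
lemma IsPhrase.length_le {n P l : ℕ} (hh : 2 ≤ h)
    (hf : IsPhrase (factor (zLetter p h) 0 n) P (factor (zLetter p h) P l)) :
    P + l ≤ max P p + 7 := by
  by_contra! hlt
  rcases hf with hf | ⟨-, j, hj, ho⟩
  · rw [length_factor] at hf
    omega
  obtain ⟨l, rfl⟩ : ∃ l', l = l' + 1 := ⟨l - 1, by omega⟩
  rw [factor_succ, List.dropLast_concat] at ho
  have hj1 := ho.1
  obtain ⟨t, ht1, ht2⟩ : ∃ t, max P p ≤ p + 4 * t ∧ p + 4 * t ≤ max P p + 3 :=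
    ⟨(max P p - p + 3) / 4, by omega, by omega⟩
  have e1 := ho.eq_of_lt (i := p + 4 * t - P) (by omega)
  have e2 := ho.eq_of_lt (i := p + 4 * t - P + 2) (by omega)
  rw [show P + (p + 4 * t - P) = p + 4 * t by omega] at e1
  rw [show P + (p + 4 * t - P + 2) = p + 4 * t + 2 by omega, ← add_assoc] at e2
  exact zLetter_pair_ne hh (by omega) e1 e2

/-- If the last letter were `1`, the whole phrase would have an earlier occurrence and one more
letter could be added. As `P + (l + 1) < n`, such a letter exists. -/
lemma le_last_of_greedy {n P l : ℕ} (hh : 2 ≤ h) (hp : 1 ≤ p) (hP : p ≤ P) (hl : P + (l + 1) < n)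
    (hf : IsPhrase (factor (zLetter p h) 0 n) P (factor (zLetter p h) P (l + 1)))
    (hmax : ∀ g, g <+: (factor (zLetter p h) 0 n).drop P →
      IsPhrase (factor (zLetter p h) 0 n) P g → g.length ≤ l + 1) :
    h ≤ zLetter p h (P + l) := by
  rcases zLetter_eq_one_or (p := p) (h := h) (P + l) with h1 | ⟨-, -, h1⟩
  swap
  · exact h1
  exfalso
  suffices hex : ∃ j, j ≤ P ∧
      OccursAt (factor (zLetter p h) P (l + 1)) (factor (zLetter p h) 0 n) j by
    have := hmax (factor (zLetter p h) P (l + 1 + 1)) (factor_prefix_drop hl)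
      (Or.inr ⟨by simp, by rwa [factor_succ, List.dropLast_concat]⟩)
    simp at this
  rcases hf with hf | ⟨hl1, j, hj, ho⟩
  -- The phrase `1` occurs at the first position, because the padding is non-empty.
  · have hl0 : l = 0 := by simpa using hf
    subst hl0
    refine ⟨1, by omega, occursAt_factor (b := 0) (by omega) fun i hi => ?_⟩
    obtain rfl : i = 0 := by omega
    rw [h1, zLetter_of_lt (by omega)]
  · rw [length_factor] at hl1
    obtain ⟨l, rfl⟩ : ∃ l', l = l' + 1 := ⟨l - 1, by omega⟩
    rw [factor_succ, List.dropLast_concat] at ho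
    have hj1 := ho.1
    have hodd : (P + (l + 1) - p) % 2 = 1 := by
      by_contra hne
      have := zLetter_of_even (h := h) (p := p) (m := P + (l + 1)) (by omega) (by omega)
      omega
    have hprev := zLetter_of_even (h := h) (p := p) (m := P + l) (by omega) (by omega)
    rw [ho.eq_of_lt (i := l) (by omega)] at hprev
    -- The copied part ends in a large letter, and its source is followed by `1` as well.
    have hnext : zLetter p h (j - 1 + (l + 1)) = 1 := by
      rcases zLetter_eq_one_or (p := p) (h := h) (j - 1 + l) with h2 | ⟨h2, h3, -⟩
      · omega
      · exact zLetter_of_odd (by omega)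
    refine ⟨j, hj, ?_⟩
    have := occursAt_factor (g := zLetter p h) (n := n) (a := P) (b := j - 1) (l := l + 1 + 1)
      (by omega) fun i hi => ?_
    · rwa [Nat.sub_add_cancel hj1] at this
    · rcases (by omega : i < l + 1 ∨ i = l + 1) with hi' | rfl
      · exact ho.eq_of_lt hi'
      · rw [h1, hnext]

/-- If every letter from `h` on takes at least `Q` bits, then so do, up to a factor, all letters
of the string after its first `p` ones in the greedy encoding. -/
lemma Encoders.le_length_bits_of_greedy (E : Encoders) {n : ℕ} {Q : ℝ} (hh : 2 ≤ h) (hp : 1 ≤ p)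
    (hQ0 : 0 ≤ Q) (hQ : ∀ x, h ≤ x → Q ≤ (E.ec x).length)
    {w : List Bool} (hw : E.IsGreedyEncoding (factor (zLetter p h) 0 n) w) :
    Q * (n - p) ≤ 7 * w.length + 14 * Q := by
  obtain ⟨fs, ts, ⟨⟨hfs, hph⟩, hmax⟩, ⟨hlen, hts⟩, rfl⟩ := hw
  have hn : fs.flatten.length = n := by rw [hfs, length_factor]
  have hfac : ∀ i (hi : i < fs.length),
      fs[i] = factor (zLetter p h) (startOf fs i) fs[i].length := by
    intro i hi
    apply eq_factor_of_prefix_drop (n := n)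
    have hsplit : factor (zLetter p h) 0 n = (fs.take i).flatten ++ (fs.drop i).flatten := by
      rw [← hfs, ← List.flatten_append, List.take_append_drop]
    rw [hsplit, startOf, List.drop_left, List.drop_eq_getElem_cons hi, List.flatten_cons]
    exact List.prefix_append _ _
  have hbound : ∀ i (hi : i < fs.length), startOf fs (i + 1) ≤ max (startOf fs i) p + 7 := by
    intro i hi
    rw [startOf_succ _ _ hi]
    have := hph i hi
    rw [hfac i hi] at this
    exact IsPhrase.length_le hh this
  have hmono : ∀ i, ((E.bits (ts.take i)).length : ℝ) ≤ (E.bits ts).length := by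
    intro i
    have hsplit : E.bits ts = E.bits (ts.take i) ++ E.bits (ts.drop i) := by
      simp only [Encoders.bits]
      rw [← List.flatMap_append, List.take_append_drop]
    rw [hsplit, List.length_append]
    push_cast
    exact le_add_of_nonneg_right (Nat.cast_nonneg _)
  -- Each phrase starting at `p` or later pays `Q` for at most 7 letters; the slack `7 * Q` covers
  -- the overshoot of the phrase that leaves the padding. The final phrase is excluded, as it may
  -- end in `1`; it costs another `7 * Q` below.
  have key : ∀ i ≤ fs.length, startOf fs i < n →
      Q * (startOf fs i - p) ≤ 7 * (E.bits (ts.take i)).length + 7 * Q := by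
    intro i
    induction i with
    | zero =>
      intro _ _
      have : (0 : ℝ) ≤ p := Nat.cast_nonneg p
      simp [startOf, Encoders.bits]
      nlinarith
    | succ i ih =>
      intro hi hlt
      have hi' : i < fs.length := hi
      have hs := startOf_succ fs i hi'
      have hb := hbound i hi'
      rcases lt_or_ge (startOf fs i) p with hc | hc
      · have h1 : (startOf fs (i + 1) : ℝ) ≤ p + 7 := by
          rw [max_eq_right hc.le] at hb
          exact_mod_cast hb
        have h2 : (0 : ℝ) ≤ (E.bits (ts.take (i + 1))).length := Nat.cast_nonneg _
        nlinarith
      · rw [max_eq_left hc] at hb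
        have ih' := ih hi'.le (by omega)
        have hi'' : i < ts.length := hlen ▸ hi'
        rw [List.take_succ_eq_append_getElem hi'', E.length_bits_append]
        have hpos : fs[i].length ≠ 0 := by
          rcases hph i hi' with h | h <;> omega
        obtain ⟨l, hl⟩ := Nat.exists_eq_succ_of_ne_zero hpos
        have hf := hfac i hi'
        have hP := hph i hi'
        have hM := hmax i hi'
        rw [hl] at hf hM
        rw [hf] at hP
        have hlast := le_last_of_greedy hh hp hc (by omega) hP hM
        have hc' := (hts i hi').2.1
        rw [hf, factor_succ] at hc'
        simp only [List.getLast?_append, List.getLast?_singleton, Option.some_or,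
          Option.some.injEq] at hc'
        have h1 := hQ _ hlast
        rw [hc'] at h1
        have h2 : ((E.ec ts[i].c).length : ℝ) ≤ E.cost ts[i] := by
          exact_mod_cast Nat.le_add_left _ _
        have h3 : (startOf fs (i + 1) : ℝ) ≤ startOf fs i + 7 := by exact_mod_cast hb
        push_cast
        nlinarith
  rcases Nat.eq_zero_or_pos n with rfl | hn0
  · have : (0 : ℝ) ≤ p := Nat.cast_nonneg p
    push_cast
    nlinarith [Nat.cast_nonneg (α := ℝ) (E.bits ts).length]
  have hex : ∃ i, i < fs.length ∧ startOf fs i < n ∧ startOf fs (i + 1) = n := by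
    have hne : 0 < fs.length := by
      rw [List.length_pos_iff]
      rintro rfl
      simp at hn
      omega
    refine ⟨fs.length - 1, by omega, ?_, ?_⟩
    · have hs := startOf_succ fs (fs.length - 1) (by omega)
      have hle := startOf_le fs (fs.length - 1 + 1)
      rcases hph (fs.length - 1) (by omega) with h | h <;> omega
    · rw [Nat.sub_add_cancel hne, startOf_length, hn]
  obtain ⟨i, hi, hi1, hi2⟩ := hex
  have hk := key i hi.le hi1
  have hm := hmono i
  have hb := hbound i hi
  rw [hi2] at hb
  have h0 : (0 : ℝ) ≤ (E.bits (ts.take i)).length := Nat.cast_nonneg _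
  rcases le_total (startOf fs i) p with hc | hc
  · rw [max_eq_right hc] at hb
    have hb' : (n : ℝ) ≤ p + 7 := by exact_mod_cast hb
    nlinarith
  · rw [max_eq_left hc] at hb
    have hb' : (n : ℝ) ≤ startOf fs i + 7 := by exact_mod_cast hb
    nlinarith

/-! ### A short encoding of the string -/

lemma size_le_of_lt {x m : ℕ} (hx : x < 2 ^ m) : Nat.size x ≤ m := Nat.size_le.mpr hx

lemma Encoders.reaches_row (E : Encoders) {n t w B G : ℕ}
    (hB : ∀ t : Triple, E.cost t ≤ B * (Nat.size t.d + Nat.size t.len + Nat.size t.c + 3))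
    (hG : Nat.size (h + 2 * zRow t) + 9 ≤ G) (hn : p + 4 * t + 2 ≤ n)
    (hr : E.Reaches (factor (zLetter p h) 0 n) (p + 4 * t) w) :
    E.Reaches (factor (zLetter p h) 0 n) (p + 4 * t + 2) (w + B * reuseCost G (zCol t)) := by
  have hone : zLetter p h (p + 4 * t + 1) = 1 := zLetter_of_odd (by omega)
  have hs1 : Nat.size 1 = 1 := by simp
  have hs2 : Nat.size 2 = 2 := by decide
  by_cases hc : zCol t = 0
  -- Column 0: two single letters, of cost (1 + size + 3) + (1 + 1 + 3) = size + 9 in units of `B`.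
  · refine ((hr.letter (by omega)).letter (by omega)).mono ?_
    have h1 := hB ⟨0, 1, zLetter p h (p + 4 * t)⟩
    have h2 := hB ⟨0, 1, zLetter p h (p + 4 * t + 1)⟩
    simp only [hone, zLetter_row, hs1, Nat.size_zero] at h1 h2 ⊢
    simp only [reuseCost, hc, if_true]
    nlinarith
  · obtain ⟨t', hlt, he, hd⟩ := exists_prev_zRow_eq t hc
    refine (hr.copy (b := p + 4 * t') (l := 1) le_rfl (by omega) (by omega) fun i hi => ?_).mono ?_
    · obtain rfl : i = 0 := by omega
      rw [add_zero, add_zero, zLetter_row, zLetter_row, he]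
    · have h1 := hB ⟨p + 4 * t - (p + 4 * t' + 1), 1 + 1, zLetter p h (p + 4 * t + 1)⟩
      -- Each cell takes 4 letters, so the distance is below 4 · 4^v. In the column case the bound
      -- is 8 · 4^v, and 3 + 2 + 1 + 3 gives the 9 in `reuseCost`.
      have h2 : Nat.size (p + 4 * t - (p + 4 * t' + 1)) ≤ 2 * padicValNat 2 (zCol t) + 2 := by
        apply size_le_of_lt
        rw [pow_add, pow_mul]
        norm_num
        omega
      simp only [hone, hs1, one_add_one_eq_two, hs2] at h1 ⊢
      simp only [reuseCost, hc, if_false]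
      refine Nat.add_le_add_left (h1.trans (Nat.mul_le_mul_left _ ?_)) _
      omega

lemma Encoders.reaches_col (E : Encoders) {n t w B G : ℕ}
    (hB : ∀ t : Triple, E.cost t ≤ B * (Nat.size t.d + Nat.size t.len + Nat.size t.c + 3))
    (hG : Nat.size (h + 2 * zCol t + 1) + 9 ≤ G) (hn : p + 4 * t + 4 ≤ n)
    (hr : E.Reaches (factor (zLetter p h) 0 n) (p + 4 * t + 2) w) :
    E.Reaches (factor (zLetter p h) 0 n) (p + 4 * t + 4) (w + B * reuseCost G (zRow t)) := by
  have hone : zLetter p h (p + 4 * t + 2 + 1) = 1 := zLetter_of_odd (by omega)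
  have hs1 : Nat.size 1 = 1 := by simp
  have hs2 : Nat.size 2 = 2 := by decide
  by_cases hc : zRow t = 0
  · refine ((hr.letter (by omega)).letter (by omega)).mono ?_
    have h1 := hB ⟨0, 1, zLetter p h (p + 4 * t + 2)⟩
    have h2 := hB ⟨0, 1, zLetter p h (p + 4 * t + 2 + 1)⟩
    simp only [hone, zLetter_col, hs1, Nat.size_zero] at h1 h2 ⊢
    simp only [reuseCost, hc, if_true]
    nlinarith
  · obtain ⟨t', hlt, he, hd⟩ := exists_prev_zCol_eq t hc
    refine (hr.copy (b := p + 4 * t' + 2) (l := 1) le_rfl (by omega) (by omega)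
      fun i hi => ?_).mono ?_
    · obtain rfl : i = 0 := by omega
      rw [add_zero, add_zero, zLetter_col, zLetter_col, he]
    · have h1 := hB ⟨p + 4 * t + 2 - (p + 4 * t' + 2 + 1), 1 + 1, zLetter p h (p + 4 * t + 2 + 1)⟩
      have h2 : Nat.size (p + 4 * t + 2 - (p + 4 * t' + 2 + 1)) ≤
          2 * padicValNat 2 (zRow t) + 3 := by
        apply size_le_of_lt
        rw [pow_add, pow_mul]
        norm_num
        omega
      simp only [hone, hs1, one_add_one_eq_two, hs2] at h1 ⊢
      simp only [reuseCost, hc, if_false]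
      refine Nat.add_le_add_left (h1.trans (Nat.mul_le_mul_left _ ?_)) _
      omega

lemma Encoders.lzOpt_zLetter_le (E : Encoders) {n k B G : ℕ}
    (hB : ∀ t : Triple, E.cost t ≤ B * (Nat.size t.d + Nat.size t.len + Nat.size t.c + 3))
    (hp : 3 ≤ p) (hn : n = p + 4 * 4 ^ k) (hh : h + 2 * 2 ^ k ≤ n) (hG : Nat.size n + 9 ≤ G) :
    E.lzOpt (factor (zLetter p h) 0 n) ≤ B * (G + 2 * (2 ^ k * G + 11 * 4 ^ k)) := by
  -- The padding takes two phrases: one `1`, then a self-overlapping copy at distance 0.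
  have h0 : E.Reaches (factor (zLetter p h) 0 n) p (B * G) := by
    have hs1 : Nat.size 1 = 1 := by simp
    have h1 := (E.reaches_zero (factor (zLetter p h) 0 n)).letter (by omega)
    have h2 := h1.copy (b := 0) (l := p - 2) (by omega) (by omega) (by omega) fun i hi => by
      rw [zLetter_of_lt (by omega), zLetter_of_lt (by omega)]
    rw [show 0 + 1 + (p - 2 + 1) = p by omega] at h2
    refine h2.mono ?_
    rw [zLetter_of_lt (by omega), zLetter_of_lt (by omega)]
    have c1 := hB ⟨0, 1, 1⟩
    have c2 := hB ⟨0 + 1 - (0 + 1), p - 2 + 1, 1⟩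
    have c3 : Nat.size (p - 2 + 1) ≤ Nat.size n := Nat.size_le_size (by omega)
    simp only [hs1, Nat.size_zero, Nat.sub_self] at c1 c2 ⊢
    nlinarith
  have key : ∀ m ≤ 4 ^ k, E.Reaches (factor (zLetter p h) 0 n) (p + 4 * m)
      (B * (G + ∑ t ∈ Finset.range m, (reuseCost G (zCol t) + reuseCost G (zRow t)))) := by
    intro m
    induction m with
    | zero => intro _; simpa using h0
    | succ m ih =>
      intro hm
      have hrow := zRow_lt k m hm
      have hcol := zCol_lt k m hm
      have r := E.reaches_col hB
        ((Nat.add_le_add_right (Nat.size_le_size (by omega)) 9).trans hG) (by omega)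
        (E.reaches_row hB ((Nat.add_le_add_right (Nat.size_le_size (by omega)) 9).trans hG)
          (by omega) (ih (by omega)))
      rw [show p + 4 * (m + 1) = p + 4 * m + 4 by ring, Finset.sum_range_succ]
      exact r.mono (by linarith)
  have hfin := key (4 ^ k) le_rfl
  rw [← hn] at hfin
  have hlen : (factor (zLetter p h) 0 n).length = n := length_factor _ _ _
  rw [← hlen] at hfin
  conv at hfin => arg 2; rw [hlen]
  refine hfin.lzOpt_le.trans (Nat.mul_le_mul_left _ ?_)
  rw [Finset.sum_add_distrib]
  have := sum_reuseCost_zCol_le G k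
  have := sum_reuseCost_zRow_le G k
  omega

end
end LZ77

namespace LZ77

/-! ### The ratio -/

lemma zLetter_mem {n p h k m : ℕ} (hn : n = p + 4 * 4 ^ k) (hh : h + 2 * 2 ^ k = n) (hm : m < n) :
    zLetter p h m ∈ insert 1 (Finset.Ico h n) := by
  have hrow := zRow_lt k ((m - p) / 4)
  have hcol := zCol_lt k ((m - p) / 4)
  rw [zLetter, Finset.mem_insert, Finset.mem_Ico]
  split_ifs
  · exact Or.inl rfl
  · have := hrow (by omega)
    omega
  · have := hcol (by omega)
    omega

/-- Ensures that the grid, of at most 4 (log n)² letters, and a padding of at least 3 fit into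
length `n`. -/
lemma four_mul_sq_add_three_le {L : ℕ} (hL : 10 ≤ L) : 4 * L ^ 2 + 3 ≤ 2 ^ L := by
  induction L, hL using Nat.le_induction with
  | base => norm_num
  | succ L hL ih =>
    rw [pow_succ 2 L]
    nlinarith

lemma Encoders.le_ratio_zLetter (E : Encoders) {a : ℝ} {n p h k B : ℕ} (ha : 0 < a)
    (hec : ∀ x : ℕ, 1 ≤ x → a * Real.logb 2 ((x : ℝ) + 1) ≤ (E.ec x).length) (hB0 : 0 < B)
    (hB : ∀ t : Triple, E.cost t ≤ B * (Nat.size t.d + Nat.size t.len + Nat.size t.c + 3))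
    (hk : 8 ≤ 2 ^ k) (hsize : Nat.size n + 9 ≤ 4 * 2 ^ k)
    (hp : 3 ≤ p) (hn : n = p + 4 * 4 ^ k) (hh : h + 2 * 2 ^ k = n) (hhn : n ≤ 2 * h) :
    a / (238 * B) * Real.logb 2 n ≤ (E.lzGr (factor (zLetter p h) 0 n) : ℝ) /
      (E.lzOpt (factor (zLetter p h) 0 n) : ℝ) := by
  have h4 : (4 : ℕ) ^ k = 2 ^ k * 2 ^ k := by rw [← mul_pow]; norm_num
  have hn4 : (4 : ℝ) ≤ n := by
    have : 4 ≤ n := by omega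
    exact_mod_cast this
  have hlog : 2 ≤ Real.logb 2 n := by
    rw [Real.le_logb_iff_rpow_le (by norm_num) (by linarith)]
    norm_num
    exact_mod_cast hn4
  have hopt := E.lzOpt_zLetter_le hB hp hn hh.le hsize
  -- With G = 4 · 2^k the bound is 4 · 2^k + (8 + 22) · 4^k ≤ 34 · 4^k, times `B`.
  have hopt' : E.lzOpt (factor (zLetter p h) 0 n) ≤ 34 * B * 4 ^ k := by
    refine hopt.trans ?_
    rw [mul_comm 34 B, mul_assoc, h4]
    exact Nat.mul_le_mul_left _ (by nlinarith)
  have hpos : 0 < E.lzOpt (factor (zLetter p h) 0 n) := by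
    refine E.lzOpt_pos fun h0 => ?_
    have := congrArg List.length h0
    simp at this
    omega
  obtain ⟨w, hw, hwl⟩ := E.exists_length_eq_lzGr (factor (zLetter p h) 0 n)
  -- Large letters are at least n/2, so their logarithm is at least log n - 1, hence at least half
  -- of log n.
  have hgr := E.le_length_bits_of_greedy (Q := a / 2 * Real.logb 2 n) (by omega) (by omega)
    (by positivity) (fun x hx => ?_) hw
  swap
  · refine le_trans ?_ (hec x (by omega))
    have h1 : Real.logb 2 n ≤ 1 + Real.logb 2 ((x : ℝ) + 1) := by
      have h2 : (n : ℝ) ≤ 2 * ((x : ℝ) + 1) := by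
        have : n ≤ 2 * (x + 1) := by omega
        exact_mod_cast this
      have h3 := Real.logb_le_logb_of_le (b := 2) (by norm_num) (by linarith) h2
      rwa [Real.logb_mul (by norm_num) (by positivity),
        Real.logb_self_eq_one (by norm_num)] at h3
    nlinarith
  rw [hwl] at hgr
  have hnp : (n : ℝ) - p = 4 * 4 ^ k := by
    rw [hn]
    push_cast
    ring
  rw [hnp] at hgr
  have h64 : (64 : ℝ) ≤ 4 ^ k := by
    have : 64 ≤ 4 ^ k := by rw [h4]; nlinarith
    exact_mod_cast this
  have hBR : (0 : ℝ) < B := by exact_mod_cast hB0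
  have hoptR : (E.lzOpt (factor (zLetter p h) 0 n) : ℝ) ≤ 34 * B * 4 ^ k := by
    exact_mod_cast hopt'
  rw [le_div_iff₀ (by exact_mod_cast hpos)]
  have hal : 0 < a * Real.logb 2 n := by positivity
  calc a / (238 * B) * Real.logb 2 n * (E.lzOpt (factor (zLetter p h) 0 n) : ℝ)
      ≤ a / (238 * B) * Real.logb 2 n * (34 * B * 4 ^ k) :=
        mul_le_mul_of_nonneg_left hoptR (by positivity)
    _ = a * Real.logb 2 n * 4 ^ k / 7 := by field_simp; norm_num
    -- As 4^k ≥ 64, the error `14 * Q` is absorbed by one of the four copies of `Q * 4 ^ k`. The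
    -- constant 238 is 34 · 7.
    _ ≤ E.lzGr (factor (zLetter p h) 0 n) := by nlinarith

lemma Encoders.one_le_ratio (E : Encoders) {s : List ℕ} (hs : s ≠ []) :
    1 ≤ (E.lzGr s : ℝ) / (E.lzOpt s : ℝ) := by
  rw [one_le_div (by exact_mod_cast E.lzOpt_pos hs)]
  exact_mod_cast E.lzOpt_le_lzGr s

end LZ77

theorem theorem3 :
    ∃ C : ℝ, 0 < C ∧ ∀ E : LZ77.Encoders, ∃ c : ℝ, 0 < c ∧ ∀ n : ℕ, 1 < n →
      ∃ (A : Finset ℕ) (s : List ℕ),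
        (∀ a ∈ A, a ≤ n) ∧ (A.card : ℝ) ≤ C * Real.logb 2 n ∧
        s.length = n ∧ (∀ a ∈ s, a ∈ A) ∧
        c * Real.logb 2 n ≤ (E.lzGr s : ℝ) / (E.lzOpt s : ℝ) := by
  refine ⟨3, by norm_num, fun E => ?_⟩
  obtain ⟨a, _, ha, -, hec⟩ := E.ec_log
  obtain ⟨B, hB0, hB⟩ := E.exists_cost_le
  have hBR : (0 : ℝ) < B := by exact_mod_cast hB0
  refine ⟨min (1 / 10) (a / (238 * B)), by positivity, fun n hn => ?_⟩
  have hlog1 : (Nat.log 2 n : ℝ) ≤ Real.logb 2 n := by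
    simpa using Real.natLog_le_logb n 2
  have hnlt : n < 2 ^ (Nat.log 2 n + 1) := Nat.lt_pow_succ_log_self (by norm_num) n
  have hlen : 2 ^ Nat.log 2 n ≤ n := Nat.pow_log_le_self 2 (by omega)
  generalize hL : Nat.log 2 n = L at *
  have hL1 : 1 ≤ L := by
    rcases Nat.eq_zero_or_pos L with rfl | h
    · norm_num at hnlt
      omega
    · exact h
  have hL1R : (1 : ℝ) ≤ L := by exact_mod_cast hL1
  have hlog0 : 0 ≤ Real.logb 2 n := by linarith
  rcases lt_or_ge L 10 with hsmall | hlarge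
  -- For n < 2^10 the trivial ratio 1 suffices, thanks to the constant 1/10.
  · refine ⟨{1}, List.replicate n 1, by simp; omega, by simp; linarith, by simp, by simp, ?_⟩
    refine le_trans ?_ (E.one_le_ratio fun h0 => by simp at h0; omega)
    have hup : Real.logb 2 n ≤ 10 := by
      rw [Real.logb_le_iff_le_rpow (by norm_num) (by positivity)]
      have : n ≤ 2 ^ 10 := hnlt.le.trans (Nat.pow_le_pow_right (by norm_num) (by omega))
      exact_mod_cast this
    have hmin : min (1 / 10) (a / (238 * B)) ≤ 1 / 10 := min_le_left _ _
    nlinarith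
  · obtain ⟨k, hk1, hk2⟩ : ∃ k, 2 ^ k ≤ L ∧ L < 2 ^ (k + 1) :=
      ⟨Nat.log 2 L, Nat.pow_log_le_self 2 (by omega), Nat.lt_pow_succ_log_self (by norm_num) L⟩
    have hk3 : 8 ≤ 2 ^ k := by
      have : 3 ≤ k := by
        by_contra! hlt
        have := Nat.pow_le_pow_right (n := 2) (by norm_num) (by omega : k + 1 ≤ 3)
        omega
      exact Nat.pow_le_pow_right (n := 2) (by norm_num) this
    rw [pow_succ] at hk2
    have h4 : (4 : ℕ) ^ k = 2 ^ k * 2 ^ k := by rw [← mul_pow]; norm_num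
    have hfit := LZ77.four_mul_sq_add_three_le hlarge
    have hfit' : 4 * 4 ^ k + 3 ≤ n := by
      rw [h4]
      nlinarith
    have hsq : 8 * 2 ^ k ≤ 4 ^ k := by rw [h4]; exact Nat.mul_le_mul_right _ hk3
    have hsize : Nat.size n ≤ L + 1 := LZ77.size_le_of_lt hnlt
    -- The large letters are the top 2 · 2^k values below `n`, which makes them expensive; with `1`
    -- they number at most 3 log n.
    refine ⟨insert 1 (Finset.Ico (n - 2 * 2 ^ k) n),
      LZ77.factor (LZ77.zLetter (n - 4 * 4 ^ k) (n - 2 * 2 ^ k)) 0 n, ?_, ?_, by simp, ?_, ?_⟩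
    · intro x hx
      rw [Finset.mem_insert, Finset.mem_Ico] at hx
      omega
    · have hcard := Finset.card_insert_le 1 (Finset.Ico (n - 2 * 2 ^ k) n)
      rw [Nat.card_Ico] at hcard
      have h3 : (insert 1 (Finset.Ico (n - 2 * 2 ^ k) n)).card ≤ 3 * L := by omega
      have h3R : ((insert 1 (Finset.Ico (n - 2 * 2 ^ k) n)).card : ℝ) ≤ 3 * L := by
        exact_mod_cast h3
      linarith
    · intro x hx
      simp only [LZ77.factor, List.mem_map, List.mem_range, zero_add] at hx
      obtain ⟨m, hm, rfl⟩ := hx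
      exact LZ77.zLetter_mem (k := k) (by omega) (by omega) hm
    · refine le_trans (mul_le_mul_of_nonneg_right (min_le_right _ _) hlog0) ?_
      exact E.le_ratio_zLetter ha (fun x hx => (hec x hx).1) hB0 hB hk3 (by omega) (by omega)
        (by omega) (by omega) (by omega)
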